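/- Let $(R,\mathfrak m)$ be a commutative Noetherian local ring of (Krull) dimension $d$, and let $\varphi:R\to R$ be a ring endomorphism of finite length, i.e. $\varphi$ is a local homomorphism and the ideal $\varphi(\mathfrak m)R$ is $\mathfrak m$-primary. For $n\ge 1$ let $\varphi^n$ be the $n$-fold composition and put $$\lambda(\varphi^n)=\ell_R\big(R/\varphi^n(\mathfrak m)R\big),\qquad v(\varphi^n)=\max\{k\in\mathbb N:\varphi^n(\mathfrak m)R\subseteq\mathfrak m^k\},\qquad w(\varphi^n)=\min\{k\in\mathbb N:\mathfrak m^k\subseteq\varphi^n(\mathfrak m)R\}.$$ (If $\varphi^n(\mathfrak m)R=0$, which is possible only when $d=0$, the maximum does not exist; in that case $\log v(\varphi^n)$ is read as $0$.) Then the limits $$h_{\mathrm{alg}}(\varphi,R)=\lim_{n\to\infty}\frac{\log\lambda(\varphi^n)}{n},\qquad v_h(\varphi)=\lim_{n\to\infty}\frac{\log v(\varphi^n)}{n},\qquad w_h(\varphi)=\lim_{n\to\infty}\frac{\log w(\varphi^n)}{n}$$ exist in $\mathbb R$, and $$d\cdot v_h(\varphi)\le h_{\mathrm{alg}}(\varphi,R)\le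 d\cdot w_h(\varphi).$$ Moreover, if $w(\varphi^n)\not\to\infty$ as $n\to\infty$ (in particular, if the sequence $w(\varphi^n)$ is bounded), then $h_{\mathrm{alg}}(\varphi,R)=0$. -/

import Mathlib

open Filter Topology

namespace LocalEntropy

open IsLocalRing

/-- A homomorphism `f : (R, 𝔪) → (S, 𝔫)` of local rings is of finite length if it is local
and the ideal `f(𝔪)S` is `𝔫`-primary. -/
structure FiniteLength {R S : Type*} [CommRing R] [IsLocalRing R] [CommRing S] [IsLocalRing S]
    (f : R →+* S) : Prop where
  isLocalHom : IsLocalHom f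
  isPrimary : ((maximalIdeal R).map f).IsPrimary
  radical_eq : ((maximalIdeal R).map f).radical = maximalIdeal S

/-- The length `λ(f) = ℓ_S(S / f(𝔪)S)`; for `f` of finite length over a Noetherian `S` the
length is finite, see `coe_lam`. -/
noncomputable def lam {R S : Type*} [CommRing R] [IsLocalRing R] [CommRing S] [IsLocalRing S]
    (f : R →+* S) : ℕ :=
  (Module.length S (S ⧸ (maximalIdeal R).map f)).toNat

section SelfMap

variable {R : Type*} [CommRing R] [IsLocalRing R]

/-- `v(φ)` is the largest `k` with `φ(𝔪)R ⊆ 𝔪 ^ k`. The maximum exists when `φ(𝔪)R ≠ 0`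
(see `isGreatest_v`). If `φ(𝔪)R = 0` every `k` qualifies and the value is `0`, so that
`Real.log (v φ) = 0`; for `φ` of finite length this happens only in dimension zero
(see `ringKrullDim_eq_zero_of_map_eq_bot`). -/
noncomputable def v (φ : R →+* R) : ℕ :=
  sSup {k : ℕ | (maximalIdeal R).map φ ≤ maximalIdeal R ^ k}

/-- `w(φ)` is the smallest `k` with `𝔪 ^ k ⊆ φ(𝔪)R`. -/
noncomputable def w (φ : R →+* R) : ℕ :=
  sInf {k : ℕ | maximalIdeal R ^ k ≤ (maximalIdeal R).map φ}

/-- The algebraic entropy `h_alg(φ, R) = lim (log λ(φⁿ)) / n`. -/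
noncomputable def hAlg (φ : R →+* R) : ℝ :=
  limUnder atTop (fun n : ℕ => Real.log (lam (φ ^ n)) / n)

/-- `v_h(φ) = lim (log v(φⁿ)) / n`. -/
noncomputable def vH (φ : R →+* R) : ℝ :=
  limUnder atTop (fun n : ℕ => Real.log (v (φ ^ n)) / n)

/-- `w_h(φ) = lim (log w(φⁿ)) / n`. -/
noncomputable def wH (φ : R →+* R) : ℝ :=
  limUnder atTop (fun n : ℕ => Real.log (w (φ ^ n)) / n)

end SelfMap

theorem ringKrullDim_eq_zero_of_map_eq_bot {R : Type*} [CommRing R] [IsLocalRing R]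
    {φ : R →+* R} (h : FiniteLength φ)
    (h0 : (maximalIdeal R).map φ = ⊥) : ringKrullDim R = 0 := by
  have hr := h.radical_eq
  rw [h0] at hr
  have : Ring.KrullDimLE 0 R := by
    refine Ring.krullDimLE_zero_iff.2 fun I hI => ?_
    have hle : maximalIdeal R ≤ I := by
      rw [← hr]
      exact hI.radical_le_iff.2 bot_le
    rw [← (maximalIdeal.isMaximal R).eq_of_le hI.ne_top hle]
    infer_instance
  exact ringKrullDimZero_iff_ringKrullDim_eq_zero.1 this

section Checks

variable {R : Type*} [CommRing R] [IsLocalRing R] [IsNoetherianRing R] {φ : R →+* R}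

theorem FiniteLength.exists_pow_le (h : FiniteLength φ) :
    ∃ k : ℕ, maximalIdeal R ^ k ≤ (maximalIdeal R).map φ := by
  have := Ideal.exists_radical_pow_le_of_fg ((maximalIdeal R).map φ)
    (IsNoetherian.noetherian _)
  rwa [h.radical_eq] at this

theorem isLeast_w (h : FiniteLength φ) :
    IsLeast {k : ℕ | maximalIdeal R ^ k ≤ (maximalIdeal R).map φ} (w φ) :=
  ⟨Nat.sInf_mem h.exists_pow_le, fun _ hk => Nat.sInf_le hk⟩

theorem isGreatest_v (h : (maximalIdeal R).map φ ≠ ⊥) :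
    IsGreatest {k : ℕ | (maximalIdeal R).map φ ≤ maximalIdeal R ^ k} (v φ) := by
  have hb : BddAbove {k : ℕ | (maximalIdeal R).map φ ≤ maximalIdeal R ^ k} := by
    by_contra hb
    apply h
    rw [eq_bot_iff, ← Ideal.iInf_pow_eq_bot_of_isLocalRing (maximalIdeal R)
      (Ideal.IsPrime.ne_top inferInstance)]
    refine le_iInf fun k => ?_
    rw [bddAbove_def] at hb
    push Not at hb
    obtain ⟨m, hm, hkm⟩ := hb k
    exact le_trans hm (Ideal.pow_le_pow_right hkm.le)
  exact ⟨Nat.sSup_mem ⟨0, by simp⟩ hb, fun _ hk => le_csSup hb hk⟩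

theorem coe_lam (h : FiniteLength φ) :
    (lam φ : ℕ∞) = Module.length R (R ⧸ (maximalIdeal R).map φ) := by
  have h1 : Ring.KrullDimLE 0 (R ⧸ (maximalIdeal R).map φ) := by
    rw [Ideal.krullDimLE_zero_quotient_iff_forall_minimalPrimes_isMaximal]
    intro J hJ
    have hle : maximalIdeal R ≤ J := by
      rw [← h.radical_eq]
      exact hJ.1.1.radical_le_iff.2 hJ.1.2
    rw [← (maximalIdeal.isMaximal R).eq_of_le hJ.1.1.ne_top hle]
    infer_instance
  have h2 : IsArtinianRing (R ⧸ (maximalIdeal R).map φ) :=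
    isArtinianRing_iff_krullDimLE_zero.2 h1
  have h3 : Module.length R (R ⧸ (maximalIdeal R).map φ) ≠ ⊤ := by
    rw [Module.length_eq_of_surjective (S := R) (R := R ⧸ (maximalIdeal R).map φ)
      Ideal.Quotient.mk_surjective]
    exact Module.length_ne_top
  exact ENat.natCast_toNat h3

end Checks

end LocalEntropy

/-!
The three limits exist by Fekete's lemma. Passing from `R ⧸ I` to `S ⧸ φ(I)S` multiplies lengths
by at most `λ(φ)` (`length_quotient_map_le`), so `λ(φᵐ⁺ⁿ) ≤ λ(φᵐ) λ(φⁿ)`; extending the inclusions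
`𝔪 ^ w(φⁿ) ⊆ φⁿ(𝔪)R ⊆ 𝔪 ^ v(φⁿ)` along `φᵐ` shows that `w` is submultiplicative and `v` is
supermultiplicative. Boundedness in the last case comes from `v(φⁿ) ≤ w(φⁿ)`, which is Nakayama's
lemma; if some `φᵐ(𝔪)R` vanishes, then `log v(φⁿ)` is eventually `0`.

The same inclusions give `ℓ(R ⧸ 𝔪 ^ v(φⁿ)) ≤ λ(φⁿ) ≤ ℓ(R ⧸ 𝔪 ^ w(φⁿ))`, so the inequalities
between the limits follow, after taking logarithms and dividing by `n`, from bounds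
`c nᵈ ≤ ℓ(R ⧸ 𝔪ⁿ) ≤ C nᵈ` with `0 < c` (`exists_le_length_quotient_pow`,
`exists_length_quotient_pow_le`). No Hilbert–Samuel polynomial is needed for these. The
upper bound compares `𝔪ⁿ` with `(x₁ⁿ, …, x_dⁿ)` for a system of parameters; the lower bound is an
induction along a chain of primes, where the Artin–Rees lemma for `x(R ⧸ p) ⊆ R ⧸ p` turns the
growth for the next prime into increments of the growth for `p`. All of these length estimates
rest on `ℓ(R ⧸ I) = ℓ(R ⧸ (I : x)) + ℓ(R ⧸ (I + (x)))` (`length_quotient_eq_add`).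
-/

namespace LocalEntropy

open IsLocalRing

/-! ### Colengths of ideals -/

section Colength

variable {R : Type*} [CommRing R]

theorem length_quotient_anti {I J : Ideal R} (h : I ≤ J) :
    Module.length R (R ⧸ J) ≤ Module.length R (R ⧸ I) :=
  Module.length_le_of_surjective (Submodule.factor h) (Submodule.factor_surjective h)

/-- Multiplication by `x` embeds `R ⧸ (I : x)` in `R ⧸ I`, with cokernel `R ⧸ (I + (x))`. -/
theorem length_quotient_eq_add (I : Ideal R) (x : R) :
    Module.length R (R ⧸ I) = Module.length R (R ⧸ I.colon {x}) +
      Module.length R (R ⧸ I ⊔ Ideal.span {x}) := by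
  have hx : I.colon {x} ≤ Submodule.comap (LinearMap.mulRight R x) I := fun y hy => by
    simpa [Submodule.mem_colon_singleton] using hy
  refine Module.length_eq_add_of_exact (Submodule.mapQ (I.colon {x}) I (LinearMap.mulRight R x) hx)
    (Submodule.factor (le_sup_left : I ≤ I ⊔ Ideal.span {x})) ?_
    (Submodule.factor_surjective _) ?_
  · rw [← LinearMap.ker_eq_bot, LinearMap.ker_eq_bot']
    intro y hy
    obtain ⟨y, rfl⟩ := Submodule.Quotient.mk_surjective _ y
    rw [Submodule.mapQ_apply, Submodule.Quotient.mk_eq_zero] at hy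
    rw [Submodule.Quotient.mk_eq_zero, Submodule.mem_colon_singleton]
    simpa using hy
  · intro y
    obtain ⟨y, rfl⟩ := Submodule.Quotient.mk_surjective _ y
    change (Submodule.Quotient.mk y : R ⧸ I ⊔ Ideal.span {x}) = 0 ↔ _
    rw [Submodule.Quotient.mk_eq_zero, Submodule.mem_sup]
    constructor
    · rintro ⟨a, ha, b, hb, rfl⟩
      obtain ⟨r, rfl⟩ := Ideal.mem_span_singleton'.1 hb
      refine ⟨Submodule.Quotient.mk r, ?_⟩
      rw [Submodule.mapQ_apply, Submodule.Quotient.eq]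
      simpa using ha
    · rintro ⟨r, hr⟩
      obtain ⟨r, rfl⟩ := Submodule.Quotient.mk_surjective _ r
      rw [Submodule.mapQ_apply, Submodule.Quotient.eq] at hr
      refine ⟨y - r * x, ?_, r * x, Ideal.mem_span_singleton'.2 ⟨r, rfl⟩, by ring⟩
      simpa using I.neg_mem hr

theorem length_quotient_sup_span_pow_le (J : Ideal R) (x : R) (n : ℕ) :
    Module.length R (R ⧸ J ⊔ Ideal.span {x ^ n}) ≤
      n * Module.length R (R ⧸ J ⊔ Ideal.span {x}) := by
  induction n with
  | zero =>
    have : J ⊔ Ideal.span {x ^ 0} = ⊤ := by simp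
    rw [this]
    simp
  | succ n ih =>
    rw [length_quotient_eq_add _ (x ^ n)]
    have h1 : J ⊔ Ideal.span {x} ≤ (J ⊔ Ideal.span {x ^ (n + 1)}).colon {x ^ n} := by
      refine sup_le (le_sup_left.trans Ideal.le_colon) ?_
      rw [Ideal.span_singleton_le_iff_mem, Submodule.mem_colon_singleton, smul_eq_mul, ← pow_succ']
      exact Ideal.mem_sup_right (Ideal.mem_span_singleton_self _)
    have h2 : J ⊔ Ideal.span {x ^ n} ≤ J ⊔ Ideal.span {x ^ (n + 1)} ⊔ Ideal.span {x ^ n} :=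
      sup_le (le_sup_left.trans le_sup_left) le_sup_right
    calc _ ≤ Module.length R (R ⧸ J ⊔ Ideal.span {x}) +
          n * Module.length R (R ⧸ J ⊔ Ideal.span {x}) :=
          add_le_add (length_quotient_anti h1) ((length_quotient_anti h2).trans ih)
      _ = _ := by push_cast; ring

theorem length_quotient_sup_span_image_pow_le (s : Finset R) (n : ℕ) (J : Ideal R) :
    Module.length R (R ⧸ J ⊔ Ideal.span ((fun x => x ^ n) '' (s : Set R))) ≤
      (n : ℕ∞) ^ s.card * Module.length R (R ⧸ J ⊔ Ideal.span (s : Set R)) := by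
  classical
  induction s using Finset.induction_on generalizing J with
  | empty => rw [Finset.coe_empty, Set.image_empty, Finset.card_empty, pow_zero, one_mul]
  | insert a s ha ih =>
    rw [Finset.card_insert_of_notMem ha, Finset.coe_insert, Set.image_insert_eq,
      Ideal.span_insert, Ideal.span_insert, ← sup_assoc, ← sup_assoc]
    refine (ih _).trans ?_
    rw [sup_right_comm, pow_succ, mul_assoc, sup_right_comm J (Ideal.span {a})]
    gcongr
    exact length_quotient_sup_span_pow_le _ _ _

end Colength

section Local

variable {R : Type*} [CommRing R] [IsLocalRing R]

/-- A proper ideal containing a power of `𝔪` can be enlarged by a single socle element `x`;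
each such step contributes to `S ⧸ φ(I)S` a cyclic subquotient `S ⧸ (φ(I)S : φ(x))`, which is
a quotient of `S ⧸ φ(𝔪)S`. -/
theorem length_quotient_map_le [IsNoetherianRing R] {S : Type*} [CommRing S] (φ : R →+* S)
    {k : ℕ} (I : Ideal R) (hI : maximalIdeal R ^ k ≤ I) :
    Module.length S (S ⧸ I.map φ) ≤
      Module.length R (R ⧸ I) * Module.length S (S ⧸ (maximalIdeal R).map φ) := by
  induction I using IsNoetherian.induction with
  | hgt I ih =>
  by_cases htop : I = ⊤
  · subst htop
    rw [Ideal.map_top, Module.length_eq_zero_iff.2 (Ideal.Quotient.subsingleton_iff.2 rfl)]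
    exact zero_le
  classical
  have hex : ∃ j, maximalIdeal R ^ j ≤ I := ⟨k, hI⟩
  obtain ⟨j, hj⟩ : ∃ j, Nat.find hex = j + 1 := by
    refine Nat.exists_eq_succ_of_ne_zero fun h0 => htop ?_
    have := Nat.find_spec hex
    rw [h0, pow_zero, Ideal.one_eq_top] at this
    exact top_le_iff.1 this
  have hle : maximalIdeal R ^ (j + 1) ≤ I := hj ▸ Nat.find_spec hex
  -- `j + 1` is the least exponent with `𝔪 ^ (j + 1) ⊆ I`, so any `x ∈ 𝔪 ^ j` outside `I` is a
  -- socle element.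
  obtain ⟨x, hx, hxI⟩ := SetLike.not_le_iff_exists.1 (Nat.find_min hex (m := j) (by omega))
  have hmx : ∀ y ∈ maximalIdeal R, y * x ∈ I := fun y hy => by
    refine hle ?_
    rw [pow_succ']
    exact Ideal.mul_mem_mul hy hx
  have hlt : I < I ⊔ Ideal.span {x} := by
    refine lt_of_le_of_ne le_sup_left fun h => hxI ?_
    rw [h]
    exact Ideal.mem_sup_right (Ideal.mem_span_singleton_self x)
  have h1 : 1 ≤ Module.length R (R ⧸ I.colon {x}) := by
    rw [Order.one_le_iff_pos, Module.length_pos_iff, Ideal.Quotient.nontrivial_iff,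
      Ne, Ideal.eq_top_iff_one, Submodule.mem_colon_singleton]
    simpa using hxI
  have h2 : (maximalIdeal R).map φ ≤ (Ideal.map φ I).colon {φ x} := by
    rw [Ideal.map_le_iff_le_comap]
    intro y hy
    rw [Ideal.mem_comap, Submodule.mem_colon_singleton, smul_eq_mul, ← map_mul]
    exact Ideal.mem_map_of_mem _ (hmx y hy)
  have h3 := ih _ hlt (hI.trans hlt.le)
  rw [Ideal.map_sup, Ideal.map_span, Set.image_singleton] at h3
  rw [length_quotient_eq_add (Ideal.map φ I) (φ x), length_quotient_eq_add I x, add_mul]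
  refine add_le_add ((length_quotient_anti h2).trans ?_) h3
  simpa using mul_le_mul_left h1 (Module.length S (S ⧸ (maximalIdeal R).map φ))

theorem length_quotient_ne_top [IsNoetherianRing R] {I : Ideal R} {k : ℕ}
    (h : maximalIdeal R ^ k ≤ I) : Module.length R (R ⧸ I) ≠ ⊤ := by
  have h1 : Ring.KrullDimLE 0 (R ⧸ I) := by
    rw [Ideal.krullDimLE_zero_quotient_iff_forall_minimalPrimes_isMaximal]
    intro J hJ
    have := hJ.1.1
    rw [← (maximalIdeal.isMaximal R).eq_of_le hJ.1.1.ne_top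
      (Ideal.IsPrime.le_of_pow_le (h.trans hJ.1.2))]
    infer_instance
  have h2 : IsArtinianRing (R ⧸ I) := isArtinianRing_iff_krullDimLE_zero.2 h1
  rw [Module.length_eq_of_surjective (S := R) (R := R ⧸ I) Ideal.Quotient.mk_surjective]
  exact Module.length_ne_top

/-! ### Growth of the Hilbert–Samuel function -/

/-- If `𝔪` is minimal over `(x₁, …, x_d)`, then `(x₁ⁿ, …, x_dⁿ) ⊆ 𝔪ⁿ` has colength at most
`nᵈ` times that of `(x₁, …, x_d)`. -/
theorem exists_length_quotient_pow_le [IsNoetherianRing R] {d : ℕ} (hd : ringKrullDim R = d) :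
    ∃ C : ℕ, 0 < C ∧ ∀ n : ℕ,
      Module.length R (R ⧸ maximalIdeal R ^ n) ≤ ((C * n ^ d : ℕ) : ℕ∞) := by
  obtain ⟨s, hs, hcard⟩ :=
    Ideal.exists_finset_card_eq_height_of_isNoetherianRing (maximalIdeal R)
  have hsd : s.card = d := by
    rw [← maximalIdeal_height_eq_ringKrullDim, ← hcard] at hd
    exact_mod_cast hd
  have hrad : (Ideal.span (s : Set R)).radical = maximalIdeal R := by
    refine le_antisymm ((maximalIdeal.isMaximal R).isPrime.radical_le_iff.2 hs.1.2) ?_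
    rw [Ideal.radical_eq_sInf]
    refine le_sInf fun J hJ => hs.2 ⟨hJ.2, hJ.1⟩ (le_maximalIdeal hJ.2.ne_top)
  obtain ⟨k, hk⟩ := Ideal.exists_radical_pow_le_of_fg (Ideal.span (s : Set R))
    (IsNoetherian.noetherian _)
  rw [hrad] at hk
  have hfin := length_quotient_ne_top hk
  refine ⟨(Module.length R (R ⧸ Ideal.span (s : Set R))).toNat + 1, Nat.succ_pos _, fun n => ?_⟩
  have h1 : Ideal.span ((fun x => x ^ n) '' (s : Set R)) ≤ maximalIdeal R ^ n := by
    rw [Ideal.span_le]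
    rintro _ ⟨x, hx, rfl⟩
    exact Ideal.pow_mem_pow (hs.1.2 (Ideal.subset_span hx)) n
  have h2 := length_quotient_sup_span_image_pow_le s n ⊥
  rw [bot_sup_eq, bot_sup_eq, hsd, ← ENat.natCast_toNat hfin] at h2
  refine ((length_quotient_anti h1).trans h2).trans ?_
  norm_cast
  rw [mul_comm]
  gcongr
  omega

/-- The consequence of the Artin–Rees lemma for `x(R ⧸ p) ⊆ R ⧸ p`: as `x` is a nonzerodivisor
on `R ⧸ p`, dividing by it costs only a bounded power of `I`. -/
theorem exists_colon_sup_pow_le {R : Type*} [CommRing R] [IsNoetherianRing R] (I p : Ideal R)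
    [p.IsPrime] {x : R} (hx : x ∉ p) :
    ∃ k : ℕ, ∀ n ≥ k, (p ⊔ I ^ n).colon {x} ≤ p ⊔ I ^ (n - k) := by
  obtain ⟨k, hk⟩ := I.exists_pow_inf_eq_pow_smul
    (Submodule.span R {(Submodule.Quotient.mk x : R ⧸ p)})
  refine ⟨k, fun n hn y hy => ?_⟩
  obtain ⟨a, ha, b, hb, hab⟩ := Submodule.mem_sup.1 (Submodule.mem_colon_singleton.1 hy)
  have h1 : (Submodule.Quotient.mk (y • x) : R ⧸ p) ∈
      I ^ n • (⊤ : Submodule R (R ⧸ p)) ⊓ Submodule.span R {Submodule.Quotient.mk x} := by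
    refine ⟨?_, Submodule.mem_span_singleton.2 ⟨y, rfl⟩⟩
    have : (Submodule.Quotient.mk (y • x) : R ⧸ p) = b • Submodule.Quotient.mk 1 := by
      rw [← Submodule.Quotient.mk_smul, Submodule.Quotient.eq, ← hab]
      simpa using ha
    rw [this]
    exact Submodule.smul_mem_smul hb trivial
  rw [hk n hn] at h1
  obtain ⟨z, hz, hzx⟩ := Submodule.mem_smul_span_singleton.1
    (Submodule.smul_mono le_rfl inf_le_right h1)
  rw [← Submodule.Quotient.mk_smul, Submodule.Quotient.eq, ← sub_smul, smul_eq_mul] at hzx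
  have h2 : y - z ∈ p := by
    have := (Ideal.IsPrime.mem_or_mem ‹_› hzx).resolve_right hx
    simpa using p.neg_mem this
  rw [← sub_add_cancel y z]
  exact add_mem (Ideal.mem_sup_left h2) (Ideal.mem_sup_right hz)

theorem add_pow_succ_le {a b : ℝ} (ha : 0 ≤ a) (hb : 0 ≤ b) (d : ℕ) :
    (a + b) ^ (d + 1) ≤ a ^ (d + 1) + (d + 1) * b * (a + b) ^ d := by
  induction d with
  | zero => simp
  | succ d ih =>
    have h1 : (a + b) ^ (d + 2) ≤
        (a + b) * (a ^ (d + 1) + (d + 1) * b * (a + b) ^ d) := by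
      rw [pow_succ' _ (d + 1)]
      gcongr
    have h2 : b * a ^ (d + 1) ≤ b * (a + b) ^ (d + 1) := by
      gcongr
      linarith
    push_cast
    calc _ ≤ _ := h1
      _ = a ^ (d + 2) + b * a ^ (d + 1) + (d + 1) * b * (a + b) ^ (d + 1) := by ring
      _ ≤ a ^ (d + 2) + b * (a + b) ^ (d + 1) + (d + 1) * b * (a + b) ^ (d + 1) := by gcongr
      _ = _ := by ring

/-- Summing increments of size `c nᵈ` along steps of length `k` yields growth of order
`n ^ (d + 1)`. -/
theorem exists_mul_pow_succ_le {a : ℕ → ℝ} {c : ℝ} (hc : 0 < c) {d k : ℕ} (hk : 0 < k)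
    (h0 : ∀ n, 1 ≤ n → c * n ^ d ≤ a n)
    (h1 : ∀ n, k < n → a (n - k) + c * n ^ d ≤ a n) :
    ∃ c' : ℝ, 0 < c' ∧ ∀ n : ℕ, 1 ≤ n → c' * n ^ (d + 1) ≤ a n := by
  have hk' : (0 : ℝ) < k := by exact_mod_cast hk
  refine ⟨c / ((d + 1) * k), by positivity, fun n => ?_⟩
  induction n using Nat.strong_induction_on with
  | _ n ih =>
  intro hn
  rcases le_or_gt n k with hnk | hnk
  · refine le_trans ?_ (h0 n hn)
    have h2 : (n : ℝ) ≤ (d + 1) * k := by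
      have : (n : ℝ) ≤ k := by exact_mod_cast hnk
      nlinarith [(Nat.cast_nonneg d : (0 : ℝ) ≤ d)]
    rw [div_mul_eq_mul_div, div_le_iff₀ (by positivity), pow_succ, ← mul_assoc]
    gcongr
  · refine le_trans ?_ (h1 n hnk)
    have h2 := ih (n - k) (by omega) (by omega)
    have h3 := add_pow_succ_le (Nat.cast_nonneg (n - k) : (0 : ℝ) ≤ _) hk'.le d
    have h4 : ((n - k : ℕ) : ℝ) + k = n := by
      rw [Nat.cast_sub hnk.le]
      ring
    rw [h4] at h3
    calc _ ≤ c / ((d + 1) * k) * (((n - k : ℕ) : ℝ) ^ (d + 1) + (d + 1) * k * n ^ d) := by gcongr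
      _ = c / ((d + 1) * k) * ((n - k : ℕ) : ℝ) ^ (d + 1) + c * n ^ d := by
        field_simp
      _ ≤ _ := by gcongr

/-- A chain of primes of length `d` starting at `p` forces the Hilbert–Samuel function of `R ⧸ p`
to grow at least like `nᵈ`: for `x` in the second prime but not in `p`, the lengths
`ℓ(R ⧸ (p + 𝔪ⁿ))` increase over a bounded step by at least `ℓ(R ⧸ (p + (x) + 𝔪ⁿ))`. -/
theorem exists_le_length_quotient_head_sup_pow [IsNoetherianRing R]
    (s : LTSeries (PrimeSpectrum R)) :
    ∃ c : ℝ, 0 < c ∧ ∀ n : ℕ, 1 ≤ n → c * n ^ s.length ≤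
      (Module.length R (R ⧸ s.head.asIdeal ⊔ maximalIdeal R ^ n)).toNat := by
  have hfin (p : Ideal R) (n : ℕ) : Module.length R (R ⧸ p ⊔ maximalIdeal R ^ n) ≠ ⊤ :=
    length_quotient_ne_top (k := n) le_sup_right
  induction s using RelSeries.inductionOn with
  | singleton p =>
    refine ⟨1, one_pos, fun n hn => ?_⟩
    have h1 : p.asIdeal ⊔ maximalIdeal R ^ n ≠ ⊤ := by
      refine ne_top_of_le_ne_top (maximalIdeal.isMaximal R).ne_top
        (sup_le (le_maximalIdeal p.2.ne_top) (Ideal.pow_le_self (by omega)))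
    have h2 : 1 ≤ (Module.length R (R ⧸ p.asIdeal ⊔ maximalIdeal R ^ n)).toNat := by
      rw [Nat.one_le_iff_ne_zero, Ne, ENat.toNat_eq_zero, not_or, Module.length_eq_zero_iff,
        Ideal.Quotient.subsingleton_iff]
      exact ⟨h1, hfin _ _⟩
    rw [RelSeries.singleton_length, pow_zero, mul_one]
    exact_mod_cast h2
  | cons s p hps ih =>
    obtain ⟨c, hc, ih⟩ := ih
    have hlt : p.asIdeal < s.head.asIdeal := hps
    obtain ⟨x, hxs, hxp⟩ := SetLike.exists_of_lt hlt
    obtain ⟨k, hk⟩ := exists_colon_sup_pow_le (maximalIdeal R) p.asIdeal hxp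
    have key (n : ℕ) (hn : k + 1 < n) :
        Module.length R (R ⧸ p.asIdeal ⊔ maximalIdeal R ^ (n - (k + 1))) +
          Module.length R (R ⧸ s.head.asIdeal ⊔ maximalIdeal R ^ n) ≤
        Module.length R (R ⧸ p.asIdeal ⊔ maximalIdeal R ^ n) := by
      rw [length_quotient_eq_add (p.asIdeal ⊔ maximalIdeal R ^ n) x]
      refine add_le_add (length_quotient_anti ?_) (length_quotient_anti ?_)
      · refine (hk n (by omega)).trans (sup_le_sup_left (Ideal.pow_le_pow_right (by omega)) _)
      · refine sup_le (sup_le_sup_right hlt.le _) (le_sup_of_le_left ?_)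
        rwa [Ideal.span_singleton_le_iff_mem]
    rw [RelSeries.head_cons, RelSeries.cons_length]
    refine exists_mul_pow_succ_le (a := fun n =>
      ((Module.length R (R ⧸ p.asIdeal ⊔ maximalIdeal R ^ n)).toNat : ℝ)) hc
      (Nat.succ_pos k) (fun n hn => (ih n hn).trans ?_) fun n hn => ?_
    · exact_mod_cast ENat.toNat_le_toNat (length_quotient_anti (sup_le_sup_right hlt.le _))
        (hfin _ _)
    · refine (add_le_add_right (ih n (by omega)) _).trans ?_
      have := ENat.toNat_le_toNat (key n hn) (hfin _ _)
      rw [ENat.toNat_add (hfin _ _) (hfin _ _)] at this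
      exact_mod_cast this

theorem exists_le_length_quotient_pow [IsNoetherianRing R] {d : ℕ} (hd : ringKrullDim R = d) :
    ∃ c : ℝ, 0 < c ∧ ∀ n : ℕ, 1 ≤ n → c * n ^ d ≤
      (Module.length R (R ⧸ maximalIdeal R ^ n)).toNat := by
  obtain ⟨s, rfl⟩ := Order.le_krullDim_iff.1 hd.ge
  obtain ⟨c, hc, h⟩ := exists_le_length_quotient_head_sup_pow s
  refine ⟨c, hc, fun n hn => (h n hn).trans ?_⟩
  exact_mod_cast ENat.toNat_le_toNat (length_quotient_anti le_sup_right)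
    (length_quotient_ne_top le_rfl)

/-! ### Invariants of a composition -/

theorem FiniteLength.map_le {φ : R →+* R} (h : FiniteLength φ) :
    (maximalIdeal R).map φ ≤ maximalIdeal R :=
  Ideal.le_radical.trans h.radical_eq.le

theorem map_mul_eq {R : Type*} [CommRing R] (f g : R →+* R) (I : Ideal R) : I.map (f * g) = (I.map g).map f :=
  (Ideal.map_map g f).symm

theorem FiniteLength.one : FiniteLength (1 : R →+* R) := by
  have h : (maximalIdeal R).map (1 : R →+* R) = maximalIdeal R := Ideal.map_id _
  refine ⟨⟨fun _ h => h⟩, ?_, ?_⟩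
  · rw [h]
    exact (maximalIdeal.isMaximal R).isPrime.isPrimary
  · rw [h]
    exact (maximalIdeal.isMaximal R).isPrime.radical

theorem pow_mul_le_map_mul {f g : R →+* R} {a b : ℕ}
    (hf : maximalIdeal R ^ a ≤ (maximalIdeal R).map f)
    (hg : maximalIdeal R ^ b ≤ (maximalIdeal R).map g) :
    maximalIdeal R ^ (a * b) ≤ (maximalIdeal R).map (f * g) := by
  rw [map_mul_eq, pow_mul]
  refine (Ideal.pow_right_mono hf b).trans ?_
  rw [← Ideal.map_pow]
  exact Ideal.map_mono hg

theorem map_mul_le_pow_mul {f g : R →+* R} {a b : ℕ}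
    (hf : (maximalIdeal R).map f ≤ maximalIdeal R ^ a)
    (hg : (maximalIdeal R).map g ≤ maximalIdeal R ^ b) :
    (maximalIdeal R).map (f * g) ≤ maximalIdeal R ^ (a * b) := by
  rw [map_mul_eq, pow_mul]
  refine (Ideal.map_mono hg).trans ?_
  rw [Ideal.map_pow]
  exact Ideal.pow_right_mono hf b

variable [IsNoetherianRing R]

theorem FiniteLength.mul {f g : R →+* R} (hf : FiniteLength f) (hg : FiniteLength g) :
    FiniteLength (f * g) := by
  have hle : (maximalIdeal R).map (f * g) ≤ maximalIdeal R := by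
    rw [map_mul_eq]
    exact (Ideal.map_mono hg.map_le).trans hf.map_le
  obtain ⟨a, ha⟩ := hf.exists_pow_le
  obtain ⟨b, hb⟩ := hg.exists_pow_le
  have hrad : ((maximalIdeal R).map (f * g)).radical = maximalIdeal R :=
    le_antisymm ((maximalIdeal.isMaximal R).isPrime.radical_le_iff.2 hle)
      fun x hx => ⟨a * b, pow_mul_le_map_mul ha hb (Ideal.pow_mem_pow hx _)⟩
  have := hf.isLocalHom
  have := hg.isLocalHom
  refine ⟨RingHom.isLocalHom_comp f g, ?_, hrad⟩
  refine Ideal.isPrimary_of_isMaximal_radical ?_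
  rw [hrad]
  exact maximalIdeal.isMaximal R

theorem FiniteLength.pow {φ : R →+* R} (h : FiniteLength φ) (n : ℕ) : FiniteLength (φ ^ n) := by
  induction n with
  | zero => exact FiniteLength.one
  | succ n ih => exact pow_succ φ n ▸ ih.mul h

theorem lam_mul_le {f g : R →+* R} (hf : FiniteLength f) (hg : FiniteLength g) :
    lam (f * g) ≤ lam f * lam g := by
  obtain ⟨b, hb⟩ := hg.exists_pow_le
  have h := length_quotient_map_le f _ hb
  rw [← map_mul_eq, ← coe_lam (hf.mul hg), ← coe_lam hf, ← coe_lam hg, mul_comm] at h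
  exact_mod_cast h

theorem w_mul_le {f g : R →+* R} (hf : FiniteLength f) (hg : FiniteLength g) :
    w (f * g) ≤ w f * w g :=
  (isLeast_w (hf.mul hg)).2 (pow_mul_le_map_mul (isLeast_w hf).1 (isLeast_w hg).1)

theorem mul_v_le {f g : R →+* R} (hf : (maximalIdeal R).map f ≠ ⊥)
    (hg : (maximalIdeal R).map g ≠ ⊥) (hfg : (maximalIdeal R).map (f * g) ≠ ⊥) :
    v f * v g ≤ v (f * g) :=
  (isGreatest_v hfg).2 (map_mul_le_pow_mul (isGreatest_v hf).1 (isGreatest_v hg).1)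

theorem FiniteLength.lam_pos {φ : R →+* R} (h : FiniteLength φ) : 0 < lam φ := by
  have : Nontrivial (R ⧸ (maximalIdeal R).map φ) := Ideal.Quotient.nontrivial_iff.2
    (ne_top_of_le_ne_top (maximalIdeal.isMaximal R).ne_top h.map_le)
  have := Module.length_pos (R := R) (M := R ⧸ (maximalIdeal R).map φ)
  rw [← coe_lam h] at this
  exact_mod_cast this

theorem FiniteLength.w_pos {φ : R →+* R} (h : FiniteLength φ) : 0 < w φ := by
  refine Nat.pos_of_ne_zero fun h0 => (maximalIdeal.isMaximal R).ne_top ?_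
  have := (isLeast_w h).1
  rw [h0, Set.mem_ofPred_eq, pow_zero, Ideal.one_eq_top] at this
  exact top_le_iff.1 (this.trans h.map_le)

theorem FiniteLength.v_pos {φ : R →+* R} (h : FiniteLength φ)
    (h0 : (maximalIdeal R).map φ ≠ ⊥) : 0 < v φ :=
  (isGreatest_v h0).2 (show (maximalIdeal R).map φ ≤ maximalIdeal R ^ 1 by simpa using h.map_le)

/-- If `w φ < v φ`, then `𝔪 ^ w φ = 𝔪 ^ (w φ + 1)`, and Nakayama's lemma gives `φ(𝔪)R = 0`. -/
theorem FiniteLength.v_le_w {φ : R →+* R} (h : FiniteLength φ)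
    (h0 : (maximalIdeal R).map φ ≠ ⊥) : v φ ≤ w φ := by
  by_contra! hlt
  have hv : (maximalIdeal R).map φ ≤ maximalIdeal R ^ v φ := (isGreatest_v h0).1
  have hw : maximalIdeal R ^ w φ ≤ (maximalIdeal R).map φ := (isLeast_w h).1
  have h1 : maximalIdeal R ^ w φ ≤ maximalIdeal R • maximalIdeal R ^ w φ := by
    rw [smul_eq_mul, ← pow_succ']
    exact (hw.trans hv).trans (Ideal.pow_le_pow_right hlt)
  have h2 := Submodule.eq_bot_of_le_smul_of_le_jacobson_bot _ _ (IsNoetherian.noetherian _) h1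
    (maximalIdeal_le_jacobson _)
  exact h0 (le_bot_iff.1 (h2 ▸ hv.trans (Ideal.pow_le_pow_right hlt.le)))

theorem lam_le_of_pow_le {φ : R →+* R} {k : ℕ}
    (hk : maximalIdeal R ^ k ≤ (maximalIdeal R).map φ) :
    lam φ ≤ (Module.length R (R ⧸ maximalIdeal R ^ k)).toNat :=
  ENat.toNat_le_toNat (length_quotient_anti hk) (length_quotient_ne_top le_rfl)

theorem le_lam_of_le_pow {φ : R →+* R} (h : FiniteLength φ) {k : ℕ}
    (hk : (maximalIdeal R).map φ ≤ maximalIdeal R ^ k) :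
    (Module.length R (R ⧸ maximalIdeal R ^ k)).toNat ≤ lam φ :=
  ENat.toNat_le_toNat (length_quotient_anti hk)
    (length_quotient_ne_top h.exists_pow_le.choose_spec)

end Local

/-! ### Existence of the limits -/

theorem subadditive_log {u : ℕ → ℕ} (hpos : ∀ n, 0 < u n) (hmul : ∀ m n, u (m + n) ≤ u m * u n) :
    Subadditive fun n => Real.log (u n) := fun m n => by
  have hm : (u m : ℝ) ≠ 0 := by exact_mod_cast (hpos m).ne'
  have hn : (u n : ℝ) ≠ 0 := by exact_mod_cast (hpos n).ne'
  rw [← Real.log_mul hm hn]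
  exact Real.log_le_log (by exact_mod_cast hpos _) (by exact_mod_cast hmul m n)

theorem exists_tendsto_log_div {u : ℕ → ℕ} (hpos : ∀ n, 0 < u n)
    (hmul : ∀ m n, u (m + n) ≤ u m * u n) :
    ∃ L : ℝ, Tendsto (fun n : ℕ => Real.log (u n) / n) atTop (𝓝 L) := by
  refine ⟨_, (subadditive_log hpos hmul).tendsto_lim ⟨0, ?_⟩⟩
  rintro _ ⟨n, rfl⟩
  exact div_nonneg (Real.log_natCast_nonneg _) (Nat.cast_nonneg n)

/-- Fekete's lemma for a supermultiplicative sequence `u`; a convergent majorant of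
`log (u n) / n` bounds it from above. -/
theorem exists_tendsto_log_div_of_supermultiplicative {u t : ℕ → ℕ} (hpos : ∀ n, 0 < u n)
    (hmul : ∀ m n, u m * u n ≤ u (m + n)) (hle : ∀ n, u n ≤ t n) {L : ℝ}
    (ht : Tendsto (fun n : ℕ => Real.log (t n) / n) atTop (𝓝 L)) :
    ∃ L : ℝ, Tendsto (fun n : ℕ => Real.log (u n) / n) atTop (𝓝 L) := by
  have hsub : Subadditive fun n => -Real.log (u n) := fun m n => by
    have hm : (u m : ℝ) ≠ 0 := by exact_mod_cast (hpos m).ne'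
    have hn : (u n : ℝ) ≠ 0 := by exact_mod_cast (hpos n).ne'
    rw [← neg_add, ← Real.log_mul hm hn, neg_le_neg_iff]
    exact Real.log_le_log (by positivity) (by exact_mod_cast hmul m n)
  obtain ⟨B, hB⟩ := ht.bddAbove_range
  have hbdd : BddBelow (Set.range fun n : ℕ => -Real.log (u n) / n) := by
    refine ⟨-B, ?_⟩
    rintro _ ⟨n, rfl⟩
    have h1 : Real.log (u n) / n ≤ Real.log (t n) / n := by
      gcongr
      · exact_mod_cast hpos n
      · exact hle n
    have h2 : Real.log (t n) / n ≤ B := hB ⟨n, rfl⟩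
    simp only [neg_div]
    linarith
  refine ⟨_, (hsub.tendsto_lim hbdd).neg.congr fun n => ?_⟩
  simp [neg_div]

section Limits

variable {R : Type*} [CommRing R] [IsLocalRing R] [IsNoetherianRing R] {φ : R →+* R}

theorem tendsto_hAlg (hφ : FiniteLength φ) :
    Tendsto (fun n : ℕ => Real.log (lam (φ ^ n)) / n) atTop (𝓝 (hAlg φ)) :=
  tendsto_nhds_limUnder <| exists_tendsto_log_div (fun n => (hφ.pow n).lam_pos)
    fun m n => pow_add φ m n ▸ lam_mul_le (hφ.pow m) (hφ.pow n)

theorem tendsto_wH (hφ : FiniteLength φ) :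
    Tendsto (fun n : ℕ => Real.log (w (φ ^ n)) / n) atTop (𝓝 (wH φ)) :=
  tendsto_nhds_limUnder <| exists_tendsto_log_div (fun n => (hφ.pow n).w_pos)
    fun m n => pow_add φ m n ▸ w_mul_le (hφ.pow m) (hφ.pow n)

/-- Once `φᵐ(𝔪)R = 0`, all later images vanish as well, and `v` takes its junk value `0`. -/
theorem v_pow_eq_zero (hφ : FiniteLength φ) {m n : ℕ} (hmn : m ≤ n)
    (h0 : (maximalIdeal R).map (φ ^ m) = ⊥) : v (φ ^ n) = 0 := by
  have h : (maximalIdeal R).map (φ ^ n) = ⊥ := by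
    rw [← Nat.add_sub_cancel' hmn, pow_add, map_mul_eq, ← le_bot_iff, ← h0]
    exact Ideal.map_mono (hφ.pow _).map_le
  have hu : {k : ℕ | (maximalIdeal R).map (φ ^ n) ≤ maximalIdeal R ^ k} = Set.univ := by
    simp [h]
  rw [v, hu, Nat.sSup_of_not_bddAbove not_bddAbove_univ]

theorem tendsto_vH (hφ : FiniteLength φ) :
    Tendsto (fun n : ℕ => Real.log (v (φ ^ n)) / n) atTop (𝓝 (vH φ)) := by
  refine tendsto_nhds_limUnder ?_
  by_cases h : ∃ m, (maximalIdeal R).map (φ ^ m) = ⊥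
  · obtain ⟨m, hm⟩ := h
    refine ⟨0, tendsto_const_nhds.congr' ?_⟩
    filter_upwards [eventually_ge_atTop m] with n hn
    simp [v_pow_eq_zero hφ hn hm]
  · push Not at h
    exact exists_tendsto_log_div_of_supermultiplicative (fun n => (hφ.pow n).v_pos (h n))
      (fun m n => pow_add φ m n ▸ mul_v_le (h m) (h n) (pow_add φ m n ▸ h (m + n)))
      (fun n => (hφ.pow n).v_le_w (h n)) (tendsto_wH hφ)

/-! ### Comparison of the limits -/

theorem mul_vH_le_hAlg {d : ℕ} (hd : ringKrullDim R = d) (hφ : FiniteLength φ) :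
    d * vH φ ≤ hAlg φ := by
  by_cases h : ∃ m, (maximalIdeal R).map (φ ^ m) = ⊥
  · obtain ⟨m, hm⟩ := h
    have hd0 : d = 0 := by
      have := ringKrullDim_eq_zero_of_map_eq_bot (hφ.pow m) hm
      rw [hd] at this
      exact_mod_cast this
    rw [hd0, Nat.cast_zero, zero_mul]
    exact ge_of_tendsto' (tendsto_hAlg hφ) fun n =>
      div_nonneg (Real.log_natCast_nonneg _) (Nat.cast_nonneg n)
  · push Not at h
    obtain ⟨c, hc, hcn⟩ := exists_le_length_quotient_pow hd
    have hlim := (tendsto_const_div_atTop_nhds_zero_nat (Real.log c)).add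
      ((tendsto_vH hφ).const_mul (d : ℝ))
    rw [zero_add] at hlim
    refine le_of_tendsto_of_tendsto' hlim (tendsto_hAlg hφ) fun n => ?_
    have hv := (hφ.pow n).v_pos (h n)
    have hv' : (0 : ℝ) < v (φ ^ n) := by exact_mod_cast hv
    have h1 : c * (v (φ ^ n) : ℝ) ^ d ≤ lam (φ ^ n) :=
      (hcn _ hv).trans (by exact_mod_cast le_lam_of_le_pow (hφ.pow n) (isGreatest_v (h n)).1)
    have h2 := Real.log_le_log (by positivity) h1
    rw [Real.log_mul hc.ne' (by positivity), Real.log_pow] at h2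
    rw [← mul_div_assoc, ← add_div]
    gcongr

theorem hAlg_le_mul_wH {d : ℕ} (hd : ringKrullDim R = d) (hφ : FiniteLength φ) :
    hAlg φ ≤ d * wH φ := by
  obtain ⟨C, hC, hCn⟩ := exists_length_quotient_pow_le hd
  have hlim := (tendsto_const_div_atTop_nhds_zero_nat (Real.log C)).add
    ((tendsto_wH hφ).const_mul (d : ℝ))
  rw [zero_add] at hlim
  refine le_of_tendsto_of_tendsto' (tendsto_hAlg hφ) hlim fun n => ?_
  have hw' : (0 : ℝ) < w (φ ^ n) := by exact_mod_cast (hφ.pow n).w_pos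
  have hC' : (0 : ℝ) < C := by exact_mod_cast hC
  have h1 : lam (φ ^ n) ≤ C * w (φ ^ n) ^ d :=
    (lam_le_of_pow_le (isLeast_w (hφ.pow n)).1).trans
      (ENat.toNat_le_of_le_natCast (hCn _))
  have h1' : (lam (φ ^ n) : ℝ) ≤ C * (w (φ ^ n) : ℝ) ^ d := by exact_mod_cast h1
  have h2 := Real.log_le_log (by exact_mod_cast (hφ.pow n).lam_pos) h1'
  rw [Real.log_mul hC'.ne' (by positivity), Real.log_pow] at h2
  rw [← mul_div_assoc, ← add_div]
  gcongr

/-- If `w(φⁿ) ≤ M` for infinitely many `n`, then `λ(φⁿ) ≤ ℓ(R ⧸ 𝔪 ^ M)` for these `n`. -/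
theorem hAlg_eq_zero_of_not_tendsto (hφ : FiniteLength φ)
    (h : ¬ Tendsto (fun n : ℕ => w (φ ^ n)) atTop atTop) : hAlg φ = 0 := by
  rw [tendsto_atTop] at h
  push Not at h
  obtain ⟨M, hM⟩ := h
  refine le_antisymm ?_ (ge_of_tendsto' (tendsto_hAlg hφ) fun n =>
    div_nonneg (Real.log_natCast_nonneg _) (Nat.cast_nonneg n))
  refine le_of_tendsto_of_tendsto_of_frequently (tendsto_hAlg hφ)
    (tendsto_const_div_atTop_nhds_zero_nat
      (Real.log (Module.length R (R ⧸ maximalIdeal R ^ M)).toNat)) ?_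
  refine hM.mono fun n hn => ?_
  have h1 := lam_le_of_pow_le
    ((Ideal.pow_le_pow_right hn.le).trans (isLeast_w (hφ.pow n)).1)
  gcongr
  exact_mod_cast (hφ.pow n).lam_pos

end Limits

end LocalEntropy

theorem mainTheorem8 {R : Type*} [CommRing R] [IsLocalRing R] [IsNoetherianRing R]
    (d : ℕ) (hd : ringKrullDim R = d)
    (φ : R →+* R) (hφ : LocalEntropy.FiniteLength φ) :
    Tendsto (fun n : ℕ => Real.log (LocalEntropy.lam (φ ^ n)) / n) atTop
        (𝓝 (LocalEntropy.hAlg φ)) ∧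
      Tendsto (fun n : ℕ => Real.log (LocalEntropy.v (φ ^ n)) / n) atTop
        (𝓝 (LocalEntropy.vH φ)) ∧
      Tendsto (fun n : ℕ => Real.log (LocalEntropy.w (φ ^ n)) / n) atTop
        (𝓝 (LocalEntropy.wH φ)) ∧
      d * LocalEntropy.vH φ ≤ LocalEntropy.hAlg φ ∧
      LocalEntropy.hAlg φ ≤ d * LocalEntropy.wH φ ∧
      (¬ Tendsto (fun n : ℕ => LocalEntropy.w (φ ^ n)) atTop atTop →
        LocalEntropy.hAlg φ = 0) :=
  ⟨LocalEntropy.tendsto_hAlg hφ, LocalEntropy.tendsto_vH hφ, LocalEntropy.tendsto_wH hφ,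
    LocalEntropy.mul_vH_le_hAlg hd hφ, LocalEntropy.hAlg_le_mul_wH hd hφ,
    LocalEntropy.hAlg_eq_zero_of_not_tendsto hφ⟩
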